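/- Let $T>0$, let $A\in\mathbb R^{n\times n}$ be nonsingular, let $B\in\mathbb R^{n\times 1}$, and assume that $(A,B)$ is controllable. Let $N\ge 1$, let $0\le U_{\min}=U_1<U_2<\dots<U_N=1$, put $\mathbb U=\{\pm U_1,\dots,\pm U_N\}$, and let $w_1,\dots,w_N$ be weights with $w_1>0$, $w_i\ge 0$ for all $i$ and $w_1+\dots+w_N=1$. For a control $u:[0,T]\to\mathbb R$ put $J(u)=\sum_{i=1}^N w_i\bigl(\|u-U_i\|_{1}+\|u+U_i\|_{1}\bigr)$, where $\|v\|_1=\int_0^T|v(t)|\,dt$, and let $\|u\|_\infty$ be the essential supremum of $|u|$ on $[0,T]$. For $\xi\in\mathbb R^n$, a control $u$ is feasible for $\xi$ if it is measurable, $\|u\|_\infty\le 1$, and the solution of $\dot x=Ax+Bu$ with $x(0)=\xi$ satisfies $x(T)=0$; an optimal control for $\xi$ is a feasible control that minimizes $J$ among all controls feasible for $\xi$. Let $\mathcal R=\{\int_0^T e^{-At}Bu(t)\,dt:\|u\|_\infty\le 1\}$, let $J_{\min}=2T\sum_{i=1}^N w_iU_i$, and let $\mathcal R_{\min}$ be the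 set of the initial states at which the optimal value is $J_{\min}$, i.e. which have an optimal control $u$ with $J(u)=J_{\min}$. Then (0) $J_{\min}$ is the minimum of $J$ over all measurable $u$ with $\|u\|_\infty\le1$, and $\mathcal R_{\min}=\{\int_0^T e^{-At}Bu(t)\,dt:\|u\|_\infty\le U_{\min}\}$; (i) if $\xi\in\mathcal R\setminus\mathcal R_{\min}$, then every optimal control $u$ for $\xi$ satisfies $u(t)\in\mathbb U$ for almost every $t\in[0,T]$; (ii) if $\xi\in\mathcal R_{\min}$, then every optimal control $u$ for $\xi$ satisfies $|u(t)|\le U_{\min}$ for almost every $t\in[0,T]$. -/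

import Mathlib

open MeasureTheory Set

noncomputable section

namespace SOAV

/-- `x` is the (Carathéodory) trajectory on `[0, τ]` of `ẋ = A x + B u` with input `u`:
it is continuous and satisfies the integrated equation, so that it is absolutely continuous and
solves the differential equation almost everywhere. -/
def IsTrajectory {n : ℕ} (A : Matrix (Fin n) (Fin n) ℝ) (B : Fin n → ℝ) (τ : ℝ)
    (u : ℝ → ℝ) (x : ℝ → Fin n → ℝ) : Prop :=
  ContinuousOn x (Icc 0 τ) ∧
    ∀ t ∈ Icc (0 : ℝ) τ, x t = x 0 + ∫ s in (0 : ℝ)..t, (A.mulVec (x s) + u s • B)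

/-- Complete (state) controllability of the pair `(A, B)`: every state can be steered to every
other state in some finite time by an integrable input. -/
def Controllable {n : ℕ} (A : Matrix (Fin n) (Fin n) ℝ) (B : Fin n → ℝ) : Prop :=
  ∀ x₀ x₁ : Fin n → ℝ, ∃ τ > (0 : ℝ), ∃ (u : ℝ → ℝ) (x : ℝ → Fin n → ℝ),
    IntervalIntegrable u volume 0 τ ∧ IsTrajectory A B τ u x ∧ x 0 = x₀ ∧ x τ = x₁

/-- `u` is a measurable control on `[0, T]` with `‖u‖_∞ ≤ c` (essential supremum over `[0, T]`). -/
def SupNormLE (T c : ℝ) (u : ℝ → ℝ) : Prop :=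
  AEStronglyMeasurable u (volume.restrict (Icc 0 T)) ∧
    eLpNorm u ⊤ (volume.restrict (Icc 0 T)) ≤ ENNReal.ofReal c

/-- The feasible controls for the initial state `ξ`: `‖u‖_∞ ≤ 1` and the corresponding trajectory
goes from `x 0 = ξ` to `x T = 0`. -/
def feasible {n : ℕ} (A : Matrix (Fin n) (Fin n) ℝ) (B : Fin n → ℝ) (T : ℝ)
    (ξ : Fin n → ℝ) : Set (ℝ → ℝ) :=
  {u | SupNormLE T 1 u ∧ ∃ x : ℝ → Fin n → ℝ, IsTrajectory A B T u x ∧ x 0 = ξ ∧ x T = 0}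

/-- The `L¹` norm on `[0, T]`. -/
def normOne (T : ℝ) (u : ℝ → ℝ) : ℝ := ∫ t in (0 : ℝ)..T, |u t|

/-- The sum-of-absolute-values cost
`J(u) = ∑_{i=1}^N w_i (‖u - U_i‖₁ + ‖u + U_i‖₁)`. -/
def cost (N : ℕ) (U w : ℕ → ℝ) (T : ℝ) (u : ℝ → ℝ) : ℝ :=
  ∑ i ∈ Finset.Icc 1 N,
    w i * (normOne T (fun t => u t - U i) + normOne T (fun t => u t + U i))

/-- `u` is a SOAV optimal control for the initial state `ξ`. -/
def IsOptimal {n : ℕ} (A : Matrix (Fin n) (Fin n) ℝ) (B : Fin n → ℝ) (N : ℕ) (U w : ℕ → ℝ)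
    (T : ℝ) (ξ : Fin n → ℝ) (u : ℝ → ℝ) : Prop :=
  u ∈ feasible A B T ξ ∧ ∀ v ∈ feasible A B T ξ, cost N U w T u ≤ cost N U w T v

/-- The set of the vectors `∫₀ᵀ e^{-At} B u(t) dt` with `‖u‖_∞ ≤ c`. -/
def reachSet {n : ℕ} (A : Matrix (Fin n) (Fin n) ℝ) (B : Fin n → ℝ) (T c : ℝ) :
    Set (Fin n → ℝ) :=
  {ξ | ∃ u : ℝ → ℝ, SupNormLE T c u ∧
    ξ = ∫ t in (0 : ℝ)..T, (NormedSpace.exp (-(t • A))).mulVec (u t • B)}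

/-- The value `J_min = 2 T ∑_{i=1}^N w_i U_i`. -/
def Jmin (N : ℕ) (U w : ℕ → ℝ) (T : ℝ) : ℝ := 2 * T * ∑ i ∈ Finset.Icc 1 N, w i * U i

/-- The set of the initial states at which the optimal value is equal to `J_min`. -/
def Rmin {n : ℕ} (A : Matrix (Fin n) (Fin n) ℝ) (B : Fin n → ℝ) (N : ℕ) (U w : ℕ → ℝ) (T : ℝ) :
    Set (Fin n → ℝ) :=
  {ξ | ∃ u, IsOptimal A B N U w T ξ u ∧ cost N U w T u = Jmin N U w T}

/-- The alphabet `{±U_1, …, ±U_N}`. -/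
def alphabet (N : ℕ) (U : ℕ → ℝ) : Set ℝ :=
  {v | ∃ i ∈ Finset.Icc 1 N, v = U i ∨ v = -U i}

end SOAV

end

/-!
By variation of constants, `u` steers `ξ` to the origin exactly when
`∫₀ᵀ e^{-At} B u(t) dt = -ξ` (`mem_feasible_iff`), and the cost is the integral of
`L(u(t))`, where `L(v) = 2 ∑ w_i max(|v|, U_i)` is convex, piecewise affine with kinks only at the
points `±U_i`, and minimal exactly on `[-U_1, U_1]` because `w_1 > 0`. Hence the cost of an
admissible control is `J_min` iff `|u| ≤ U_1` almost everywhere (`cost_eq_Jmin_iff`). This gives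
the value of the minimum, the description of `R_min` (the sign in `-ξ` is harmless, as `u` may be
replaced by `-u`), and the bound for optimal controls of states in `R_min`.

For a state outside `R_min`, the pairs (input integral, number above the cost) form a convex set
in a finite-dimensional space which misses the pair attained by an optimal control `u`. A
separating hyperplane gives multipliers `(φ, p) ≠ 0`, `p ≥ 0`, such that `u` minimizes
`∫ (q(t) v(t) + p L(v(t))) dt` over all admissible `v`, where `q(t) = φ(e^{-At} B)`
(`IsOptimal.exists_multipliers`), and comparison with controls modified on a measurable set makes
this a pointwise minimum (`ae_hamiltonian_le`). If `φ = 0`, then `u` minimizes the cost among all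
admissible controls, which is excluded outside `R_min`. If `φ ≠ 0`, a minimizer which is not one
of the points `±U_i` lies inside an interval on which `L` is affine, so `-q(t)` equals `p` times
one of finitely many slopes. Each such level set of `q` is null (`ae_switching_ne`): `q` is
analytic, and if it were constant, then `φ(A e^{tA} B) = 0` for all `t`, so `φ A = 0` by
controllability, and `φ = 0` because `A` is nonsingular. The abnormal case `p = 0` needs no
separate treatment.
-/

namespace SOAV

/-! ### Entries of the matrix exponential

Derivatives and analyticity are stated entrywise, so that no norm on matrices has to be fixed. -/

theorem hasDerivAt_exp_smul_apply {n : ℕ} (A : Matrix (Fin n) (Fin n) ℝ) (i j : Fin n) (t : ℝ) :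
    HasDerivAt (fun s : ℝ => (NormedSpace.exp (s • A)) i j)
      ((A * NormedSpace.exp (t • A)) i j) t := by
  open scoped Matrix.Norms.Operator in
  have h := hasDerivAt_exp_smul_const' (𝕂 := ℝ) A t
  exact hasDerivAt_pi.1 (hasDerivAt_pi.1 h i) j

theorem analyticAt_exp_smul_apply {n : ℕ} (A : Matrix (Fin n) (Fin n) ℝ) (i j : Fin n) (t : ℝ) :
    AnalyticAt ℝ (fun s : ℝ => (NormedSpace.exp (s • A)) i j) t := by
  open scoped Matrix.Norms.Operator in
  have h : AnalyticAt ℝ (fun s : ℝ => NormedSpace.exp (s • A)) t :=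
    (NormedSpace.exp_analytic (𝕂 := ℝ) (t • A)).comp_of_eq
      (analyticAt_id.smul analyticAt_const) rfl
  exact AnalyticAt.comp_of_eq (f := fun s : ℝ => NormedSpace.exp (s • A))
    ((Matrix.entryLinearMap ℝ ℝ i j).toContinuousLinearMap.analyticAt (NormedSpace.exp (t • A)))
    h rfl

theorem exp_neg_mul_exp {n : ℕ} (A : Matrix (Fin n) (Fin n) ℝ) :
    NormedSpace.exp (-A) * NormedSpace.exp A = 1 := by
  rw [← Matrix.exp_add_of_commute _ _ (Commute.neg_left (Commute.refl A)), neg_add_cancel,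
    NormedSpace.exp_zero]

/-! ### Separation in finite dimension -/

/-- Supporting functional at a point outside a convex set. No topological assumption on the set is
needed in finite dimension: a convex set with empty interior lies in a proper affine subspace,
on which some nonzero functional is constant. -/
theorem exists_ne_zero_forall_le {V : Type*} [NormedAddCommGroup V] [NormedSpace ℝ V]
    [FiniteDimensional ℝ V] {D : Set V} (hD : Convex ℝ D) (hne : D.Nonempty) {x : V}
    (hx : x ∉ D) : ∃ f : V →L[ℝ] ℝ, f ≠ 0 ∧ ∀ a ∈ D, f x ≤ f a := by
  by_cases hint : (interior D).Nonempty
  · obtain ⟨f, hf, h⟩ := geometric_hahn_banach_of_nonempty_interior_point hD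
      (fun h => hx (interior_subset h)) hint
    refine ⟨-f, neg_ne_zero.2 hf, fun a ha => ?_⟩
    simpa using h a ha
  · obtain ⟨x₀, hx₀⟩ := hne
    rw [hD.interior_nonempty_iff_affineSpan_eq_top,
      ← AffineSubspace.direction_eq_top_iff_of_nonempty ⟨x₀, subset_affineSpan ℝ D hx₀⟩] at hint
    obtain ⟨f, hf, hker⟩ := Submodule.exists_le_ker_of_lt_top _ (lt_top_iff_ne_top.2 hint)
    have hconst : ∀ a ∈ D, f a = f x₀ := fun a ha => by
      have := hker (AffineSubspace.vsub_mem_direction (subset_affineSpan ℝ D ha)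
        (subset_affineSpan ℝ D hx₀))
      simpa [sub_eq_zero] using this
    have hf' : LinearMap.toContinuousLinearMap f ≠ 0 := by
      intro h
      exact hf (LinearMap.toContinuousLinearMap.map_eq_zero_iff.1 h)
    rcases le_total (f x) (f x₀) with h | h
    · exact ⟨LinearMap.toContinuousLinearMap f, hf', fun a ha => by simpa [hconst a ha] using h⟩
    · exact ⟨-LinearMap.toContinuousLinearMap f, neg_ne_zero.2 hf',
        fun a ha => by simpa [hconst a ha] using h⟩

/-! ### Product rule for primitives of integrable functions -/

/-- Product rule, in integrated form, for a `C¹` function and the primitive of an integrable one. -/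
theorem integral_deriv_mul_primitive {m m' f : ℝ → ℝ} (hm : ∀ s, HasDerivAt m (m' s) s)
    (hm' : Continuous m') {t : ℝ} (hf : IntervalIntegrable f volume 0 t) (y₀ : ℝ) :
    ∫ s in (0 : ℝ)..t, (m' s * (y₀ + ∫ r in (0 : ℝ)..s, f r) + m s * f s) =
      m t * (y₀ + ∫ r in (0 : ℝ)..t, f r) - m 0 * y₀ := by
  have hd : deriv m = m' := funext fun s => (hm s).deriv
  have hmC : ContDiff ℝ 1 m :=
    contDiff_one_iff_deriv.2 ⟨fun s => (hm s).differentiableAt, hd ▸ hm'⟩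
  have hg : AbsolutelyContinuousOnInterval (fun s => y₀ + ∫ r in (0 : ℝ)..s, f r) 0 t :=
    (contDiff_const.contDiffOn.absolutelyContinuousOnInterval (f := fun _ => y₀)).add
      (hf.absolutelyContinuousOnInterval_intervalIntegral left_mem_uIcc)
  have key := AbsolutelyContinuousOnInterval.integral_deriv_mul_eq_sub
    hmC.contDiffOn.absolutelyContinuousOnInterval hg
  simp only [intervalIntegral.integral_same, add_zero] at key
  rw [← key]
  apply intervalIntegral.integral_congr_ae
  filter_upwards [hf.ae_hasDerivAt_integral] with s hs hst
  have := (hs (uIoc_subset_uIcc hst) 0 left_mem_uIcc).const_add y₀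
  rw [hd, this.deriv]

theorem intervalIntegral_apply {n : ℕ} {f : ℝ → Fin n → ℝ} {a b : ℝ}
    (hf : IntervalIntegrable f volume a b) (i : Fin n) :
    (∫ s in a..b, f s) i = ∫ s in a..b, f s i :=
  ((ContinuousLinearMap.proj (R := ℝ) (φ := fun _ : Fin n => ℝ) i).intervalIntegral_comp_comm
    hf).symm

theorem intervalIntegrable_pi {n : ℕ} {f : ℝ → Fin n → ℝ} {a b : ℝ} :
    IntervalIntegrable f volume a b ↔ ∀ i, IntervalIntegrable (fun s => f s i) volume a b := by
  simp only [IntervalIntegrable, IntegrableOn, integrable_pi_iff, forall_and]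

theorem intervalIntegrable_mulVec {n : ℕ} {M : ℝ → Matrix (Fin n) (Fin n) ℝ} {f : ℝ → Fin n → ℝ}
    (hM : ∀ i j, Continuous fun s => M s i j) {a b : ℝ} (hf : IntervalIntegrable f volume a b) :
    IntervalIntegrable (fun s => (M s).mulVec (f s)) volume a b := by
  rw [intervalIntegrable_pi] at hf ⊢
  intro i
  simp only [Matrix.mulVec, dotProduct]
  rw [show (fun s => ∑ j, M s i j * f s j) = ∑ j, fun s => M s i j * f s j from
    funext fun s => (Finset.sum_apply s Finset.univ fun j r => M r i j * f r j).symm]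
  exact IntervalIntegrable.sum Finset.univ
    fun j _ => (hf j).continuousOn_mul (hM i j).continuousOn

/-- Product rule, in integrated form, for a `C¹` matrix function applied to the primitive of an
integrable vector function. -/
theorem mulVec_primitive {n : ℕ} {M M' : ℝ → Matrix (Fin n) (Fin n) ℝ}
    (hM : ∀ i j s, HasDerivAt (fun r => M r i j) (M' s i j) s)
    (hM' : ∀ i j, Continuous fun s => M' s i j) {f : ℝ → Fin n → ℝ} {t : ℝ}
    (hf : IntervalIntegrable f volume 0 t) (y₀ : Fin n → ℝ) :
    (M t).mulVec (y₀ + ∫ r in (0 : ℝ)..t, f r) = (M 0).mulVec y₀ +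
      ∫ s in (0 : ℝ)..t, ((M' s).mulVec (y₀ + ∫ r in (0 : ℝ)..s, f r) + (M s).mulVec (f s)) := by
  have hMc : ∀ i j, Continuous fun s => M s i j := fun i j =>
    continuous_iff_continuousAt.2 fun s => (hM i j s).continuousAt
  have hy : ContinuousOn (fun s => y₀ + ∫ r in (0 : ℝ)..s, f r) (uIcc 0 t) :=
    continuousOn_const.add (intervalIntegral.continuousOn_primitive_interval' hf left_mem_uIcc)
  have hint := (intervalIntegrable_mulVec hM' hy.intervalIntegrable).add
    (intervalIntegrable_mulVec hMc hf)
  have hfi := intervalIntegrable_pi.1 hf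
  ext i
  rw [Pi.add_apply, intervalIntegral_apply hint]
  have hterm : ∀ j, IntervalIntegrable (fun s => M' s i j * (y₀ j + ∫ r in (0 : ℝ)..s, f r j) +
      M s i j * f s j) volume 0 t := fun j =>
    (((hM' i j).continuousOn).mul (continuousOn_const.add
      (intervalIntegral.continuousOn_primitive_interval' (hfi j)
        left_mem_uIcc))).intervalIntegrable.add
      ((hfi j).continuousOn_mul (hMc i j).continuousOn)
  have hcongr : ∫ s in (0 : ℝ)..t,
      ((M' s).mulVec (y₀ + ∫ r in (0 : ℝ)..s, f r) + (M s).mulVec (f s)) i =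
      ∫ s in (0 : ℝ)..t, ∑ j, (M' s i j * (y₀ j + ∫ r in (0 : ℝ)..s, f r j) +
        M s i j * f s j) := by
    apply intervalIntegral.integral_congr
    intro s hs
    have hfs : IntervalIntegrable f volume 0 s := hf.mono_set (uIcc_subset_uIcc_left hs)
    simp only [Matrix.mulVec, dotProduct, Pi.add_apply, intervalIntegral_apply hfs,
      Finset.sum_add_distrib]
  rw [hcongr, intervalIntegral.integral_finsetSum fun j _ => hterm j]
  simp only [integral_deriv_mul_primitive (hM i _) (hM' i _) (hfi _), Matrix.mulVec, dotProduct,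
    Pi.add_apply, intervalIntegral_apply hf, Finset.sum_sub_distrib]
  ring

/-! ### Variation of constants -/

theorem continuous_exp_neg_smul_apply {n : ℕ} (A : Matrix (Fin n) (Fin n) ℝ) (i j : Fin n) :
    Continuous fun s : ℝ => (NormedSpace.exp (-(s • A))) i j := by
  simp only [← smul_neg]
  exact continuous_iff_continuousAt.2 fun s => (hasDerivAt_exp_smul_apply (-A) i j s).continuousAt

theorem continuous_mul_apply {n : ℕ} {M : ℝ → Matrix (Fin n) (Fin n) ℝ}
    (A : Matrix (Fin n) (Fin n) ℝ) (hM : ∀ i j, Continuous fun s => M s i j) (i j : Fin n) :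
    Continuous fun s => (A * M s) i j := by
  simp only [Matrix.mul_apply]
  exact continuous_finsetSum _ fun k _ => continuous_const.mul (hM k j)

theorem intervalIntegrable_exp_mulVec {n : ℕ} (A : Matrix (Fin n) (Fin n) ℝ) (B : Fin n → ℝ)
    {u : ℝ → ℝ} {a b : ℝ} (hu : IntervalIntegrable u volume a b) :
    IntervalIntegrable (fun s => (NormedSpace.exp (-(s • A))).mulVec (u s • B)) volume a b :=
  intervalIntegrable_mulVec (continuous_exp_neg_smul_apply A)
    (intervalIntegrable_pi.2 fun i => by simpa using hu.mul_const (B i))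

/-- Variation of constants: along a trajectory, `e^{-At} x(t)` is the integral of `e^{-As} B u(s)`
up to the initial state. -/
theorem IsTrajectory.exp_neg_mulVec {n : ℕ} {A : Matrix (Fin n) (Fin n) ℝ} {B : Fin n → ℝ}
    {τ : ℝ} {u : ℝ → ℝ} {x : ℝ → Fin n → ℝ} (h : IsTrajectory A B τ u x)
    (hu : IntervalIntegrable u volume 0 τ) (hτ : 0 ≤ τ) :
    (NormedSpace.exp (-(τ • A))).mulVec (x τ) =
      x 0 + ∫ s in (0 : ℝ)..τ, (NormedSpace.exp (-(s • A))).mulVec (u s • B) := by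
  obtain ⟨hc, hx⟩ := h
  have hf : IntervalIntegrable (fun s => A.mulVec (x s) + u s • B) volume 0 τ := by
    refine IntervalIntegrable.add ?_ (intervalIntegrable_pi.2 fun i => by
      simpa using hu.mul_const (B i))
    refine intervalIntegrable_mulVec (M := fun _ => A) (fun i j => continuous_const) ?_
    exact ContinuousOn.intervalIntegrable (by rwa [uIcc_of_le hτ])
  have key := mulVec_primitive (M := fun s => NormedSpace.exp (s • (-A)))
    (fun i j s => hasDerivAt_exp_smul_apply (-A) i j s)
    (continuous_mul_apply (-A) (by simpa using continuous_exp_neg_smul_apply A)) hf (x 0)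
  rw [← hx τ (right_mem_Icc.2 hτ)] at key
  simp only [smul_neg] at key
  rw [key]
  simp only [zero_smul, neg_zero, NormedSpace.exp_zero, Matrix.one_mulVec]
  congr 1
  apply intervalIntegral.integral_congr
  intro s hs
  rw [uIcc_of_le hτ] at hs
  have hcomm : A * NormedSpace.exp (-(s • A)) = NormedSpace.exp (-(s • A)) * A :=
    (((Commute.refl A).smul_right s).neg_right.exp_right).eq
  simp only [← hx s hs, Matrix.neg_mul, hcomm, Matrix.neg_mulVec, Matrix.mulVec_add,
    Matrix.mulVec_mulVec]
  abel

/-- The input integral `∫₀ᵀ e^{-At} B u(t) dt`. The state that `u` steers to the origin in time `T`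
is its negative. -/
noncomputable def inputMap {n : ℕ} (A : Matrix (Fin n) (Fin n) ℝ) (B : Fin n → ℝ) (T : ℝ)
    (u : ℝ → ℝ) : Fin n → ℝ :=
  ∫ t in (0 : ℝ)..T, (NormedSpace.exp (-(t • A))).mulVec (u t • B)

theorem exists_isTrajectory {n : ℕ} (A : Matrix (Fin n) (Fin n) ℝ) (B : Fin n → ℝ)
    {T : ℝ} (hT : 0 ≤ T) {u : ℝ → ℝ} (hu : IntervalIntegrable u volume 0 T) (ξ : Fin n → ℝ) :
    ∃ x, IsTrajectory A B T u x ∧ x 0 = ξ ∧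
      x T = (NormedSpace.exp (T • A)).mulVec (ξ + inputMap A B T u) := by
  have hf := intervalIntegrable_exp_mulVec A B hu
  set f := fun s : ℝ => (NormedSpace.exp (-(s • A))).mulVec (u s • B) with hfdef
  have hE : ∀ i j, Continuous fun s : ℝ => (NormedSpace.exp (s • A)) i j := fun i j =>
    continuous_iff_continuousAt.2 fun s => (hasDerivAt_exp_smul_apply A i j s).continuousAt
  have hx0 : (NormedSpace.exp ((0 : ℝ) • A)).mulVec (ξ + ∫ r in (0 : ℝ)..0, f r) = ξ := by
    simp [NormedSpace.exp_zero]
  refine ⟨fun t => (NormedSpace.exp (t • A)).mulVec (ξ + ∫ r in (0 : ℝ)..t, f r),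
    ⟨?_, fun t ht => ?_⟩, hx0, rfl⟩
  · have hp : ContinuousOn (fun t => ξ + ∫ r in (0 : ℝ)..t, f r) (Icc 0 T) := by
      rw [← uIcc_of_le hT]
      exact continuousOn_const.add
        (intervalIntegral.continuousOn_primitive_interval' hf left_mem_uIcc)
    refine continuousOn_pi.2 fun i => ?_
    simp only [Matrix.mulVec, dotProduct]
    exact continuousOn_finsetSum _ fun j _ =>
      (hE i j).continuousOn.mul (continuousOn_pi.1 hp j)
  · have hft : IntervalIntegrable f volume 0 t :=
      hf.mono_set (uIcc_subset_uIcc_left (by rwa [uIcc_of_le hT]))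
    simp only [hx0]
    rw [mulVec_primitive (fun i j s => hasDerivAt_exp_smul_apply A i j s)
      (continuous_mul_apply A hE) hft ξ]
    congr 1
    · simp [NormedSpace.exp_zero]
    · refine intervalIntegral.integral_congr fun s _ => ?_
      have hinv : NormedSpace.exp (s • A) * NormedSpace.exp (-(s • A)) = 1 := by
        simpa using exp_neg_mul_exp (-(s • A))
      simp only [hfdef, Matrix.mulVec_mulVec, hinv, Matrix.one_mulVec]

/-! ### Level sets of the switching function -/

/-- A functional that vanishes on `e^{tA} B` for all `t` vanishes on every state reachable from the
origin, hence everywhere. -/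
theorem Controllable.eq_zero_of_forall {n : ℕ} {A : Matrix (Fin n) (Fin n) ℝ} {B : Fin n → ℝ}
    (hAB : Controllable A B) {ψ : (Fin n → ℝ) →L[ℝ] ℝ}
    (h : ∀ t : ℝ, ψ ((NormedSpace.exp (t • A)).mulVec B) = 0) : ψ = 0 := by
  ext y
  obtain ⟨τ, hτ, u, x, hu, hx, hx0, hxτ⟩ := hAB 0 y
  have hvc := hx.exp_neg_mulVec hu hτ.le
  have hinv : NormedSpace.exp (τ • A) * NormedSpace.exp (-(τ • A)) = 1 := by
    simpa using exp_neg_mul_exp (-(τ • A))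
  have hy : y = (NormedSpace.exp (τ • A)).mulVec
      (∫ s in (0 : ℝ)..τ, (NormedSpace.exp (-(s • A))).mulVec (u s • B)) := by
    rw [hx0, hxτ, zero_add] at hvc
    rw [← hvc, Matrix.mulVec_mulVec, hinv, Matrix.one_mulVec]
  let χ : (Fin n → ℝ) →L[ℝ] ℝ :=
    ψ ∘L (LinearMap.toContinuousLinearMap (Matrix.mulVecLin (NormedSpace.exp (τ • A))))
  have hχ : ψ y = χ (∫ s in (0 : ℝ)..τ, (NormedSpace.exp (-(s • A))).mulVec (u s • B)) := by
    rw [hy]; rfl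
  rw [hχ, ← χ.intervalIntegral_comp_comm (intervalIntegrable_exp_mulVec A B hu)]
  refine (intervalIntegral.integral_congr (g := fun _ => 0) fun s _ => ?_).trans (by simp)
  have hexp : NormedSpace.exp (τ • A) * NormedSpace.exp (-(s • A)) =
      NormedSpace.exp ((τ - s) • A) := by
    rw [← Matrix.exp_add_of_commute _ _
      ((((Commute.refl A).smul_right s).neg_right).smul_left τ), sub_smul, sub_eq_add_neg]
  change ψ ((NormedSpace.exp (τ • A)).mulVec ((NormedSpace.exp (-(s • A))).mulVec (u s • B))) = 0
  rw [Matrix.mulVec_mulVec, hexp, Matrix.mulVec_smul, map_smul, h, smul_zero]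

theorem clm_mulVec_eq_sum {n : ℕ} (φ : (Fin n → ℝ) →L[ℝ] ℝ) (M : Matrix (Fin n) (Fin n) ℝ)
    (B : Fin n → ℝ) : φ (M.mulVec B) = ∑ i, ∑ j, M i j * B j * φ (Pi.single i 1) := by
  conv_lhs => rw [pi_eq_sum_univ' (M.mulVec B)]
  simp only [map_sum, map_smul, Matrix.mulVec, dotProduct, smul_eq_mul, Finset.sum_mul]

theorem continuous_switching {n : ℕ} (A : Matrix (Fin n) (Fin n) ℝ) (B : Fin n → ℝ)
    (φ : (Fin n → ℝ) →L[ℝ] ℝ) :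
    Continuous fun t : ℝ => φ ((NormedSpace.exp (-(t • A))).mulVec B) := by
  simp only [clm_mulVec_eq_sum]
  exact continuous_finsetSum _ fun i _ => continuous_finsetSum _ fun j _ =>
    ((continuous_exp_neg_smul_apply A i j).mul continuous_const).mul continuous_const

/-- The level sets of the switching function `t ↦ φ(e^{-At} B)` are null if `φ ≠ 0`. -/
theorem ae_switching_ne {n : ℕ} {A : Matrix (Fin n) (Fin n) ℝ} {B : Fin n → ℝ}
    (hA : A.det ≠ 0) (hAB : Controllable A B) {φ : (Fin n → ℝ) →L[ℝ] ℝ} (hφ : φ ≠ 0) (c : ℝ) :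
    ∀ᵐ t : ℝ, φ ((NormedSpace.exp (-(t • A))).mulVec B) ≠ c := by
  have hanal : AnalyticOnNhd ℝ (fun t : ℝ => φ ((NormedSpace.exp (-(t • A))).mulVec B) - c)
      univ := by
    intro t _
    simp only [clm_mulVec_eq_sum, ← smul_neg]
    refine AnalyticAt.fun_sub (Finset.analyticAt_fun_sum _ fun i _ =>
      Finset.analyticAt_fun_sum _ fun j _ => ?_) analyticAt_const
    exact ((analyticAt_exp_smul_apply (-A) i j t).mul analyticAt_const).mul analyticAt_const
  by_cases hne : ∃ t₀ : ℝ, φ ((NormedSpace.exp (-(t₀ • A))).mulVec B) - c ≠ 0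
  · obtain ⟨t₀, ht₀⟩ := hne
    have hcod := ae_restrict_le_codiscreteWithin (μ := volume) MeasurableSet.univ
      (hanal.preimage_zero_mem_codiscrete ht₀)
    rw [Measure.restrict_univ] at hcod
    filter_upwards [hcod] with t ht
    simpa [sub_eq_zero] using ht
  · exfalso
    push Not at hne
    have hder : ∀ t : ℝ, φ ((A * NormedSpace.exp (t • A)).mulVec B) = 0 := by
      intro t
      have hd : HasDerivAt (fun s : ℝ => φ ((NormedSpace.exp (s • A)).mulVec B))
          (φ ((A * NormedSpace.exp (t • A)).mulVec B)) t := by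
        simp only [clm_mulVec_eq_sum]
        exact HasDerivAt.fun_sum fun i _ => HasDerivAt.fun_sum fun j _ =>
          ((hasDerivAt_exp_smul_apply A i j t).mul_const _).mul_const _
      have hconst : (fun s : ℝ => φ ((NormedSpace.exp (s • A)).mulVec B)) = fun _ => c :=
        funext fun s => by simpa [sub_eq_zero] using hne (-s)
      rw [hconst] at hd
      exact hd.unique (hasDerivAt_const t c)
    have hψ := hAB.eq_zero_of_forall
      (ψ := φ ∘L LinearMap.toContinuousLinearMap (Matrix.mulVecLin A))
      fun t => by simpa [Matrix.mulVec_mulVec] using hder t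
    refine hφ (ContinuousLinearMap.ext fun y => ?_)
    have := DFunLike.congr_fun hψ (A⁻¹.mulVec y)
    simpa [Matrix.mulVec_mulVec, Matrix.mul_nonsing_inv A (isUnit_iff_ne_zero.2 hA)] using this

/-! ### Admissible controls -/

theorem supNormLE_iff {T c : ℝ} (hc : 0 ≤ c) {u : ℝ → ℝ} :
    SupNormLE T c u ↔ AEStronglyMeasurable u (volume.restrict (Icc 0 T)) ∧
      ∀ᵐ t ∂(volume.restrict (Icc 0 T)), |u t| ≤ c := by
  refine and_congr_right fun _ => ?_
  rw [eLpNorm_exponent_top]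
  refine ⟨fun h => ?_, fun h => eLpNormEssSup_le_of_ae_bound h⟩
  filter_upwards [enorm_ae_le_eLpNormEssSup u (volume.restrict (Icc 0 T))] with t ht
  have := ht.trans h
  rwa [← ofReal_norm, ENNReal.ofReal_le_ofReal_iff hc] at this

theorem SupNormLE.intervalIntegrable_comp {T c : ℝ} (hT : 0 ≤ T) (hc : 0 ≤ c) {u : ℝ → ℝ}
    (hu : SupNormLE T c u) {L : ℝ → ℝ} (hL : Continuous L) :
    IntervalIntegrable (fun t => L (u t)) volume 0 T := by
  obtain ⟨hm, hb⟩ := (supNormLE_iff hc).1 hu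
  rw [intervalIntegrable_iff_integrableOn_Icc_of_le hT]
  obtain ⟨K, hK⟩ := (isCompact_Icc (a := -c) (b := c)).exists_bound_of_continuousOn
    hL.continuousOn
  refine Integrable.of_bound (hL.comp_aestronglyMeasurable hm) K ?_
  filter_upwards [hb] with t ht
  exact hK _ (abs_le.1 ht)

theorem SupNormLE.intervalIntegrable {T c : ℝ} (hT : 0 ≤ T) (hc : 0 ≤ c) {u : ℝ → ℝ}
    (hu : SupNormLE T c u) : IntervalIntegrable u volume 0 T :=
  hu.intervalIntegrable_comp hT hc continuous_id

theorem SupNormLE.neg {T c : ℝ} {u : ℝ → ℝ} (hu : SupNormLE T c u) :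
    SupNormLE T c (fun t => -u t) :=
  ⟨hu.1.neg, (eLpNorm_neg u ⊤ _).trans_le hu.2⟩

theorem SupNormLE.mono {T c d : ℝ} (hcd : c ≤ d) {u : ℝ → ℝ} (hu : SupNormLE T c u) :
    SupNormLE T d u :=
  ⟨hu.1, hu.2.trans (ENNReal.ofReal_le_ofReal hcd)⟩

theorem SupNormLE.convex_comb {T c : ℝ} (hc : 0 ≤ c) {u v : ℝ → ℝ} (hu : SupNormLE T c u)
    (hv : SupNormLE T c v) {a b : ℝ} (ha : 0 ≤ a) (hb : 0 ≤ b) (hab : a + b = 1) :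
    SupNormLE T c (fun t => a * u t + b * v t) := by
  rw [supNormLE_iff hc] at *
  refine ⟨(hu.1.const_mul a).add (hv.1.const_mul b), ?_⟩
  filter_upwards [hu.2, hv.2] with t h1 h2
  calc |a * u t + b * v t| ≤ |a * u t| + |b * v t| := abs_add_le _ _
    _ = a * |u t| + b * |v t| := by rw [abs_mul, abs_mul, abs_of_nonneg ha, abs_of_nonneg hb]
    _ ≤ a * c + b * c := by gcongr
    _ = c := by rw [← add_mul, hab, one_mul]

theorem inputMap_neg {n : ℕ} (A : Matrix (Fin n) (Fin n) ℝ) (B : Fin n → ℝ) (T : ℝ)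
    (u : ℝ → ℝ) : inputMap A B T (fun t => -u t) = -inputMap A B T u := by
  simp only [inputMap, neg_smul, Matrix.mulVec_neg, intervalIntegral.integral_neg]

theorem inputMap_convex_comb {n : ℕ} (A : Matrix (Fin n) (Fin n) ℝ) (B : Fin n → ℝ) {T : ℝ}
    {u v : ℝ → ℝ} (hu : IntervalIntegrable u volume 0 T) (hv : IntervalIntegrable v volume 0 T)
    (a b : ℝ) : inputMap A B T (fun t => a * u t + b * v t) =
      a • inputMap A B T u + b • inputMap A B T v := by
  have h := intervalIntegral.integral_add ((intervalIntegrable_exp_mulVec A B hu).smul a)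
    ((intervalIntegrable_exp_mulVec A B hv).smul b)
  simp only [Pi.smul_apply, intervalIntegral.integral_smul] at h
  rw [inputMap, inputMap, inputMap, ← h]
  simp only [add_smul, mul_smul, Matrix.mulVec_add, Matrix.mulVec_smul]

theorem mem_feasible_iff {n : ℕ} {A : Matrix (Fin n) (Fin n) ℝ} {B : Fin n → ℝ} {T : ℝ}
    (hT : 0 ≤ T) {ξ : Fin n → ℝ} {u : ℝ → ℝ} :
    u ∈ feasible A B T ξ ↔ SupNormLE T 1 u ∧ inputMap A B T u = -ξ := by
  refine and_congr_right fun hu => ?_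
  have hi := hu.intervalIntegrable hT zero_le_one
  constructor
  · rintro ⟨x, hx, hx0, hxT⟩
    have h := hx.exp_neg_mulVec hi hT
    rw [hx0, hxT, Matrix.mulVec_zero] at h
    exact (neg_eq_of_add_eq_zero_right h.symm).symm
  · intro h
    obtain ⟨x, hx, hx0, hxT⟩ := exists_isTrajectory A B hT hi ξ
    exact ⟨x, hx, hx0, by rw [hxT, h, add_neg_cancel, Matrix.mulVec_zero]⟩

/-! ### The running cost -/

/-- The integrand of the cost, `v ↦ ∑ i, w_i (|v - U_i| + |v + U_i|)`. -/
noncomputable def runningCost (N : ℕ) (U w : ℕ → ℝ) (v : ℝ) : ℝ :=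
  ∑ i ∈ Finset.Icc 1 N, w i * (|v - U i| + |v + U i|)

theorem continuous_runningCost (N : ℕ) (U w : ℕ → ℝ) : Continuous (runningCost N U w) := by
  unfold runningCost
  fun_prop

theorem runningCost_convex_comb_le {N : ℕ} {U w : ℕ → ℝ} (hw : ∀ i ∈ Finset.Icc 1 N, 0 ≤ w i)
    {a b : ℝ} (ha : 0 ≤ a) (hb : 0 ≤ b) (hab : a + b = 1) (x y : ℝ) :
    runningCost N U w (a * x + b * y) ≤ a * runningCost N U w x + b * runningCost N U w y := by
  unfold runningCost
  rw [Finset.mul_sum, Finset.mul_sum, ← Finset.sum_add_distrib]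
  refine Finset.sum_le_sum fun i hi => ?_
  have key : ∀ p q : ℝ, |a * p + b * q| ≤ a * |p| + b * |q| := fun p q =>
    (abs_add_le _ _).trans_eq (by
      rw [abs_mul, abs_mul, abs_of_nonneg ha, abs_of_nonneg hb])
  have h1 := key (x - U i) (y - U i)
  have h2 := key (x + U i) (y + U i)
  rw [show a * (x - U i) + b * (y - U i) = a * x + b * y - U i by linear_combination -U i * hab]
    at h1
  rw [show a * (x + U i) + b * (y + U i) = a * x + b * y + U i by linear_combination U i * hab]
    at h2
  linarith [mul_le_mul_of_nonneg_left (add_le_add h1 h2) (hw i hi)]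

theorem cost_eq_integral {N : ℕ} {U w : ℕ → ℝ} {T c : ℝ} (hT : 0 ≤ T) (hc : 0 ≤ c) {u : ℝ → ℝ}
    (hu : SupNormLE T c u) :
    cost N U w T u = ∫ t in (0 : ℝ)..T, runningCost N U w (u t) := by
  have h1 : ∀ i, IntervalIntegrable (fun t => |u t - U i|) volume 0 T := fun i =>
    hu.intervalIntegrable_comp hT hc (L := fun v => |v - U i|) (by fun_prop)
  have h2 : ∀ i, IntervalIntegrable (fun t => |u t + U i|) volume 0 T := fun i =>
    hu.intervalIntegrable_comp hT hc (L := fun v => |v + U i|) (by fun_prop)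
  simp only [cost, runningCost, normOne]
  rw [intervalIntegral.integral_finsetSum fun i _ => ((h1 i).add (h2 i)).const_mul (w i)]
  refine Finset.sum_congr rfl fun i _ => ?_
  rw [intervalIntegral.integral_const_mul, intervalIntegral.integral_add (h1 i) (h2 i)]

theorem sum_le_runningCost {N : ℕ} {U w : ℕ → ℝ} (hw : ∀ i ∈ Finset.Icc 1 N, 0 ≤ w i) (v : ℝ) :
    2 * ∑ i ∈ Finset.Icc 1 N, w i * U i ≤ runningCost N U w v := by
  rw [Finset.mul_sum]
  refine Finset.sum_le_sum fun i hi => ?_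
  have h : 2 * U i ≤ |v - U i| + |v + U i| := by
    linarith [neg_abs_le (v - U i), le_abs_self (v + U i)]
  nlinarith [mul_le_mul_of_nonneg_left h (hw i hi)]

theorem runningCost_eq_of_abs_le {N : ℕ} {U w : ℕ → ℝ} {v : ℝ}
    (hv : ∀ i ∈ Finset.Icc 1 N, |v| ≤ U i) :
    runningCost N U w v = 2 * ∑ i ∈ Finset.Icc 1 N, w i * U i := by
  rw [Finset.mul_sum]
  refine Finset.sum_congr rfl fun i hi => ?_
  have h := abs_le.1 (hv i hi)
  rw [abs_of_nonpos (by linarith : v - U i ≤ 0), abs_of_nonneg (by linarith : 0 ≤ v + U i)]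
  ring

theorem abs_le_of_runningCost_le {N : ℕ} (hN : 1 ≤ N) {U w : ℕ → ℝ} (hw1 : 0 < w 1)
    (hw : ∀ i ∈ Finset.Icc 1 N, 0 ≤ w i) {v : ℝ}
    (hv : runningCost N U w v ≤ 2 * ∑ i ∈ Finset.Icc 1 N, w i * U i) : |v| ≤ U 1 := by
  by_contra! hlt
  refine absurd hv (not_le.2 ?_)
  rw [Finset.mul_sum]
  have h : ∀ i, 2 * U i ≤ |v - U i| + |v + U i| := fun i => by
    linarith [neg_abs_le (v - U i), le_abs_self (v + U i)]
  refine Finset.sum_lt_sum (fun i hi => ?_) ⟨1, by simp [hN], ?_⟩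
  · nlinarith [mul_le_mul_of_nonneg_left (h i) (hw i hi)]
  · have : 2 * U 1 < |v - U 1| + |v + U 1| := by
      rcases lt_abs.1 hlt with h' | h'
      · linarith [le_abs_self (v - U 1), le_abs_self (v + U 1)]
      · linarith [neg_abs_le (v - U 1), neg_abs_le (v + U 1)]
    nlinarith [mul_lt_mul_of_pos_left this hw1]

/-- The running cost is affine on every interval free of the points `±U_i`, and the slopes that
occur belong to the finite set of all signed sums of the weights. -/
theorem exists_finite_slopes (N : ℕ) (U w : ℕ → ℝ) :
    ∃ S : Set ℝ, S.Finite ∧ ∀ a b v : ℝ, v ∈ Ioo a b → (∀ c ∈ alphabet N U, c ∉ Ioo a b) →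
      ∃ s ∈ S, ∀ x ∈ Icc a b, runningCost N U w x = runningCost N U w v + s * (x - v) := by
  -- on such an interval no `x - U i` or `x + U i` changes sign
  let S : Set ℝ := range fun σ : Finset.Icc 1 N → SignType × SignType =>
    ∑ i : Finset.Icc 1 N, w i * ((σ i).1 + (σ i).2 : ℝ)
  refine ⟨S, finite_range _, fun a b v hv hfree => ?_⟩
  refine ⟨_, ⟨fun i => (SignType.sign (v - U i), SignType.sign (v + U i)), rfl⟩, fun x hx => ?_⟩
  simp only [runningCost]
  rw [← Finset.sum_coe_sort (Finset.Icc 1 N), ← Finset.sum_coe_sort (Finset.Icc 1 N),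
    Finset.sum_mul, ← Finset.sum_add_distrib]
  have key : ∀ c : ℝ, c ∉ Ioo a b → |x - c| = |v - c| + (SignType.sign (v - c) : ℝ) * (x - v) := by
    intro c hc
    rcases le_or_gt c a with h | h
    · have hvc : 0 < v - c := by linarith [hv.1]
      rw [sign_pos hvc, abs_of_pos hvc, abs_of_nonneg (by linarith [hx.1])]
      simp
    · have hcb : b ≤ c := not_lt.1 fun h' => hc ⟨h, h'⟩
      have hvc : v - c < 0 := by linarith [hv.2]
      rw [sign_neg hvc, abs_of_neg hvc, abs_of_nonpos (by linarith [hx.2])]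
      simp
  refine Finset.sum_congr rfl fun i _ => ?_
  have h1 := key (U i) (hfree _ ⟨i, i.2, Or.inl rfl⟩)
  have h2 := key (-U i) (hfree _ ⟨i, i.2, Or.inr rfl⟩)
  rw [sub_neg_eq_add, sub_neg_eq_add] at h2
  rw [h1, h2]
  ring

theorem finite_alphabet (N : ℕ) (U : ℕ → ℝ) : (alphabet N U).Finite := by
  refine (((Finset.Icc 1 N).finite_toSet.image U).union
    ((Finset.Icc 1 N).finite_toSet.image fun i => -U i)).subset ?_
  rintro v ⟨i, hi, rfl | rfl⟩
  · exact Or.inl ⟨i, hi, rfl⟩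
  · exact Or.inr ⟨i, hi, rfl⟩

/-- If a value `v ∈ [-1, 1]` does at least as well for the Hamiltonian `x ↦ q x + p L(x)` as all
letters of the alphabet, then `v` is a letter or `-q` is `p` times a slope of `L`. -/
theorem mem_alphabet_or_slope {N : ℕ} {U w : ℕ → ℝ} (h1 : 1 ∈ alphabet N U)
    (hneg1 : -1 ∈ alphabet N U) {S : Set ℝ}
    (hS : ∀ a b v : ℝ, v ∈ Ioo a b → (∀ c ∈ alphabet N U, c ∉ Ioo a b) →
      ∃ s ∈ S, ∀ x ∈ Icc a b, runningCost N U w x = runningCost N U w v + s * (x - v))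
    {q p v : ℝ} (hv : |v| ≤ 1)
    (hmin : ∀ c ∈ alphabet N U, q * v + p * runningCost N U w v ≤
      q * c + p * runningCost N U w c) :
    v ∈ alphabet N U ∨ ∃ s ∈ S, q = -(p * s) := by
  by_cases hmem : v ∈ alphabet N U
  · exact Or.inl hmem
  right
  have hv' := abs_le.1 hv
  have hfin := finite_alphabet N U
  obtain ⟨a, ⟨haU, hav⟩, ha⟩ := Set.exists_max_image (alphabet N U ∩ Iic v) id
    (hfin.subset inter_subset_left) ⟨-1, hneg1, hv'.1⟩
  obtain ⟨b, ⟨hbU, hbv⟩, hb⟩ := Set.exists_min_image (alphabet N U ∩ Ici v) id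
    (hfin.subset inter_subset_left) ⟨1, h1, hv'.2⟩
  have hav' : a < v := lt_of_le_of_ne hav fun h => hmem (h ▸ haU)
  have hvb' : v < b := lt_of_le_of_ne hbv fun h => hmem (h ▸ hbU)
  obtain ⟨s, hs, haff⟩ := hS a b v ⟨hav', hvb'⟩ fun c hc hcab => by
    rcases le_total c v with h | h
    · exact (ha c ⟨hc, h⟩).not_gt hcab.1
    · exact (hb c ⟨hc, h⟩).not_gt hcab.2
  refine ⟨s, hs, ?_⟩
  have hma := hmin a haU
  have hmb := hmin b hbU
  rw [haff a ⟨le_rfl, (hav'.trans hvb').le⟩] at hma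
  rw [haff b ⟨(hav'.trans hvb').le, le_rfl⟩] at hmb
  have e1 : 0 ≤ (q + p * s) * (a - v) := by linarith
  have e2 : 0 ≤ (q + p * s) * (b - v) := by linarith
  have f1 : q + p * s ≤ 0 := by nlinarith
  have f2 : 0 ≤ q + p * s := by nlinarith
  linarith

/-! ### The minimum principle -/

/-- A continuous function of `t` and of the value of an admissible control is integrable. -/
theorem SupNormLE.integrableOn_hamiltonian {T : ℝ} {u : ℝ → ℝ} (hu : SupNormLE T 1 u)
    {H : ℝ → ℝ → ℝ} (hH : Continuous (Function.uncurry H)) :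
    IntegrableOn (fun t => H t (u t)) (Icc 0 T) := by
  obtain ⟨hm, hb⟩ := (supNormLE_iff zero_le_one).1 hu
  obtain ⟨K, hK⟩ := ((isCompact_Icc (a := (0 : ℝ)) (b := T)).prod
    (isCompact_Icc (a := (-1 : ℝ)) (b := 1))).exists_bound_of_continuousOn hH.continuousOn
  refine Integrable.of_bound
    (hH.comp_aestronglyMeasurable (aestronglyMeasurable_id.prodMk hm)) K ?_
  filter_upwards [hb, ae_restrict_mem measurableSet_Icc] with t ht htT
  exact hK (t, u t) ⟨htT, abs_le.1 ht⟩

/-- A control minimizing `∫ H(t, u(t)) dt` over the admissible controls has values that are almost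
everywhere at least as good as any constant value `c ∈ [-1, 1]`. -/
theorem ae_hamiltonian_le {T : ℝ} (hT : 0 ≤ T) {u : ℝ → ℝ} (hu : SupNormLE T 1 u)
    {H : ℝ → ℝ → ℝ} (hH : Continuous (Function.uncurry H))
    (hmin : ∀ v, SupNormLE T 1 v →
      ∫ t in (0 : ℝ)..T, H t (u t) ≤ ∫ t in (0 : ℝ)..T, H t (v t)) {c : ℝ} (hc : |c| ≤ 1) :
    ∀ᵐ t ∂(volume.restrict (Icc 0 T)), H t (u t) ≤ H t c := by
  obtain ⟨hm, hb⟩ := (supNormLE_iff zero_le_one).1 hu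
  have hmk : Measurable (hm.mk u) := hm.stronglyMeasurable_mk.measurable
  have hHm : Measurable fun z : ℝ × ℝ => H z.1 z.2 := hH.measurable
  have hset : MeasurableSet {t | H t c < H t (hm.mk u t)} :=
    measurableSet_lt (hHm.comp (measurable_id.prodMk measurable_const))
      (hHm.comp (measurable_id.prodMk hmk))
  classical
  -- the competitor is built from a measurable representative of `u` and
  -- switches to `c` wherever `c` gives a smaller value than `u`
  let v : ℝ → ℝ := {t | H t c < H t (hm.mk u t)}.piecewise (fun _ => c) (hm.mk u)
  have hv : SupNormLE T 1 v := by
    refine (supNormLE_iff zero_le_one).2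
      ⟨(Measurable.piecewise hset measurable_const hmk).aestronglyMeasurable, ?_⟩
    filter_upwards [hb, hm.ae_eq_mk] with t ht htm
    by_cases h : H t c < H t (hm.mk u t)
    · simpa [v, h] using hc
    · rw [htm] at ht
      simpa [v, h] using ht
  have hvle : ∀ᵐ t ∂(volume.restrict (Icc 0 T)), H t (v t) = min (H t (u t)) (H t c) := by
    filter_upwards [hm.ae_eq_mk] with t htm
    by_cases h : H t c < H t (hm.mk u t)
    · simp [v, h, htm, h.le]
    · simp [v, h, htm, not_lt.1 h]
  have hui := hu.integrableOn_hamiltonian hH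
  have hvi := hv.integrableOn_hamiltonian hH
  have hle := hmin v hv
  rw [intervalIntegral.integral_of_le hT, intervalIntegral.integral_of_le hT,
    ← integral_Icc_eq_integral_Ioc, ← integral_Icc_eq_integral_Ioc] at hle
  have hnn : 0 ≤ᵐ[volume.restrict (Icc 0 T)] fun t => H t (u t) - H t (v t) := by
    filter_upwards [hvle] with t ht
    simp [ht]
  have hzero := (integral_eq_zero_iff_of_nonneg_ae hnn (hui.sub hvi)).1
    (le_antisymm (by rw [integral_sub hui hvi]; linarith) (integral_nonneg_of_ae hnn))
  filter_upwards [hvle, hzero] with t h1 h2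
  have h3 : H t (u t) = H t (v t) := sub_eq_zero.1 h2
  rw [h3, h1]
  exact min_le_right _ _

/-- Multiplier rule: an optimal control minimizes a nontrivial combination of the input integral
and the cost over all admissible controls, whether feasible or not. -/
theorem IsOptimal.exists_multipliers {n : ℕ} {A : Matrix (Fin n) (Fin n) ℝ} {B : Fin n → ℝ}
    {N : ℕ} {U w : ℕ → ℝ} {T : ℝ} (hT : 0 ≤ T) (hw : ∀ i ∈ Finset.Icc 1 N, 0 ≤ w i)
    {ξ : Fin n → ℝ} {u : ℝ → ℝ} (hu : IsOptimal A B N U w T ξ u) :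
    ∃ (φ : (Fin n → ℝ) →L[ℝ] ℝ) (p : ℝ), (φ ≠ 0 ∨ p ≠ 0) ∧ 0 ≤ p ∧
      ∀ v, SupNormLE T 1 v → φ (inputMap A B T u) + p * cost N U w T u ≤
        φ (inputMap A B T v) + p * cost N U w T v := by
  obtain ⟨hfeas, hopt⟩ := hu
  obtain ⟨hadm, hu0⟩ := (mem_feasible_iff hT).1 hfeas
  -- the strict inequality in `D` keeps the pair attained by `u` outside, by optimality
  let D : Set ((Fin n → ℝ) × ℝ) :=
    {z | ∃ v, SupNormLE T 1 v ∧ z.1 = inputMap A B T v ∧ cost N U w T v < z.2}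
  have hD : Convex ℝ D := by
    rintro ⟨y₁, r₁⟩ ⟨v₁, hv₁, h₁, hr₁⟩ ⟨y₂, r₂⟩ ⟨v₂, hv₂, h₂, hr₂⟩ a b ha hb hab
    have hi₁ := hv₁.intervalIntegrable hT zero_le_one
    have hi₂ := hv₂.intervalIntegrable hT zero_le_one
    have hcomb := hv₁.convex_comb zero_le_one hv₂ ha hb hab
    refine ⟨fun t => a * v₁ t + b * v₂ t, hcomb, ?_, ?_⟩
    · rw [inputMap_convex_comb A B hi₁ hi₂]
      exact congrArg₂ (fun y z => a • y + b • z) h₁ h₂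
    · have hL := continuous_runningCost N U w
      have hc : cost N U w T (fun t => a * v₁ t + b * v₂ t) ≤
          a * cost N U w T v₁ + b * cost N U w T v₂ := by
        have j₁ := hv₁.intervalIntegrable_comp hT zero_le_one hL
        have j₂ := hv₂.intervalIntegrable_comp hT zero_le_one hL
        rw [cost_eq_integral hT zero_le_one hcomb, cost_eq_integral hT zero_le_one hv₁,
          cost_eq_integral hT zero_le_one hv₂, ← intervalIntegral.integral_const_mul,
          ← intervalIntegral.integral_const_mul,
          ← intervalIntegral.integral_add (j₁.const_mul a) (j₂.const_mul b)]
        exact intervalIntegral.integral_mono hT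
          (hcomb.intervalIntegrable_comp hT zero_le_one hL)
          ((j₁.const_mul a).add (j₂.const_mul b))
          fun t => runningCost_convex_comb_le hw ha hb hab _ _
      refine hc.trans_lt ?_
      change a * _ + b * _ < a * r₁ + b * r₂
      simp only at hr₁ hr₂
      rcases ha.eq_or_lt with rfl | ha'
      · simp_all
      · nlinarith [mul_lt_mul_of_pos_left hr₁ ha', mul_le_mul_of_nonneg_left hr₂.le hb]
  have hx : (inputMap A B T u, cost N U w T u) ∉ D := by
    rintro ⟨v, hv, hvu, hlt⟩
    exact (hopt v ((mem_feasible_iff hT).2 ⟨hv, hvu.symm.trans hu0⟩)).not_gt hlt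
  obtain ⟨f, hf, hfD⟩ := exists_ne_zero_forall_le hD
    ⟨(inputMap A B T u, cost N U w T u + 1), u, hadm, rfl, lt_add_one _⟩ hx
  have hsplit : ∀ y r, f (y, r) = f.comp (ContinuousLinearMap.inl ℝ _ ℝ) y + f (0, 1) * r := by
    intro y r
    have : ((y, r) : (Fin n → ℝ) × ℝ) = (y, 0) + r • (0, 1) := by simp
    rw [this, map_add, map_smul, smul_eq_mul, mul_comm]
    rfl
  refine ⟨f.comp (ContinuousLinearMap.inl ℝ _ ℝ), f (0, 1), ?_, ?_, fun v hv => ?_⟩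
  · by_contra! h
    exact hf (ContinuousLinearMap.ext fun ⟨y, r⟩ => by rw [hsplit, h.1, h.2]; simp)
  · have := hfD (inputMap A B T u, cost N U w T u + 1) ⟨u, hadm, rfl, lt_add_one _⟩
    rw [hsplit (inputMap A B T u) (cost N U w T u), hsplit _ (_ + 1)] at this
    linarith
  · have hlim : Filter.Tendsto (fun r : ℝ => f (inputMap A B T v, r))
        (nhdsWithin (cost N U w T v) (Ioi (cost N U w T v)))
        (nhds (f (inputMap A B T v, cost N U w T v))) :=
      ((f.continuous.comp (Continuous.prodMk_right _)).tendsto _).mono_left nhdsWithin_le_nhds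
    rw [← hsplit, ← hsplit]
    refine ge_of_tendsto hlim ?_
    filter_upwards [self_mem_nhdsWithin] with r hr
    exact hfD _ ⟨v, hv, rfl, hr⟩

/-! ### The minimal cost -/

theorem Jmin_le_cost {N : ℕ} {U w : ℕ → ℝ} {T : ℝ} (hT : 0 ≤ T)
    (hw : ∀ i ∈ Finset.Icc 1 N, 0 ≤ w i) {u : ℝ → ℝ} (hu : SupNormLE T 1 u) :
    Jmin N U w T ≤ cost N U w T u := by
  rw [cost_eq_integral hT zero_le_one hu]
  have h := intervalIntegral.integral_mono hT intervalIntegrable_const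
    (hu.intervalIntegrable_comp hT zero_le_one (continuous_runningCost N U w))
    fun t => sum_le_runningCost (U := U) hw (u t)
  refine le_of_eq_of_le ?_ h
  simp [Jmin]
  ring

theorem cost_eq_Jmin_iff {N : ℕ} (hN : 1 ≤ N) {U w : ℕ → ℝ} {T : ℝ} (hT : 0 ≤ T)
    (hU : ∀ i ∈ Finset.Icc 1 N, U 1 ≤ U i) (hw1 : 0 < w 1)
    (hw : ∀ i ∈ Finset.Icc 1 N, 0 ≤ w i) {u : ℝ → ℝ} (hu : SupNormLE T 1 u) :
    cost N U w T u = Jmin N U w T ↔ ∀ᵐ t ∂(volume.restrict (Icc 0 T)), |u t| ≤ U 1 := by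
  have hint := (intervalIntegrable_iff_integrableOn_Icc_of_le hT).1
    (hu.intervalIntegrable_comp hT zero_le_one (continuous_runningCost N U w))
  have hJ : Jmin N U w T =
      ∫ t in Icc 0 T, (fun _ => 2 * ∑ i ∈ Finset.Icc 1 N, w i * U i) t := by
    simp [Jmin, hT]
    ring
  rw [cost_eq_integral hT zero_le_one hu, intervalIntegral.integral_of_le hT,
    ← integral_Icc_eq_integral_Ioc, hJ, eq_comm, integral_eq_iff_of_ae_le
      (integrable_const _) hint (ae_of_all _ fun t => sum_le_runningCost hw (u t))]
  refine Filter.eventually_congr (ae_of_all _ fun t => ⟨fun h => ?_, fun h => ?_⟩)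
  · exact abs_le_of_runningCost_le hN hw1 hw h.ge
  · exact (runningCost_eq_of_abs_le fun i hi => h.trans (hU i hi)).symm

/-- An optimal control whose cost exceeds that of some admissible control (not necessarily
feasible for the same state) takes its values in the alphabet. -/
theorem IsOptimal.ae_mem_alphabet {n : ℕ} {A : Matrix (Fin n) (Fin n) ℝ} {B : Fin n → ℝ}
    (hA : A.det ≠ 0) (hAB : Controllable A B)
    {N : ℕ} {U w : ℕ → ℝ} (hU1 : ∀ c ∈ alphabet N U, |c| ≤ 1) (h1 : 1 ∈ alphabet N U)
    (hneg1 : -1 ∈ alphabet N U) {T : ℝ} (hT : 0 ≤ T) (hw : ∀ i ∈ Finset.Icc 1 N, 0 ≤ w i)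
    {ξ : Fin n → ℝ} {u u₀ : ℝ → ℝ} (hu : IsOptimal A B N U w T ξ u) (hu₀ : SupNormLE T 1 u₀)
    (hlt : cost N U w T u₀ < cost N U w T u) :
    ∀ᵐ t ∂(volume.restrict (Icc 0 T)), u t ∈ alphabet N U := by
  obtain ⟨φ, p, hne, hp, hmult⟩ := hu.exists_multipliers hT hw
  have hadm := hu.1.1
  have hφ : φ ≠ 0 := by
    rintro rfl
    have hp' : 0 < p := lt_of_le_of_ne hp fun h => by simp [h.symm] at hne
    have := hmult u₀ hu₀
    simp only [_root_.zero_apply, zero_add] at this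
    exact this.not_gt (mul_lt_mul_of_pos_left hlt hp')
  set q : ℝ → ℝ := fun t => φ ((NormedSpace.exp (-(t • A))).mulVec B) with hq
  have hqc : Continuous q := continuous_switching A B φ
  let H : ℝ → ℝ → ℝ := fun t v => q t * v + p * runningCost N U w v
  have hH : Continuous (Function.uncurry H) :=
    ((hqc.comp continuous_fst).mul continuous_snd).add
      (continuous_const.mul ((continuous_runningCost N U w).comp continuous_snd))
  have hHint : ∀ v, SupNormLE T 1 v → ∫ t in (0 : ℝ)..T, H t (v t) =
      φ (inputMap A B T v) + p * cost N U w T v := by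
    intro v hv
    have hvi := hv.intervalIntegrable hT zero_le_one
    have hci := hv.intervalIntegrable_comp hT zero_le_one (continuous_runningCost N U w)
    rw [intervalIntegral.integral_add (hvi.continuousOn_mul hqc.continuousOn)
      (hci.const_mul p), intervalIntegral.integral_const_mul,
      ← cost_eq_integral hT zero_le_one hv, inputMap,
      ← φ.intervalIntegral_comp_comm (intervalIntegrable_exp_mulVec A B hvi)]
    simp only [hq, Matrix.mulVec_smul, map_smul, smul_eq_mul, mul_comm]
  have hmin : ∀ c ∈ alphabet N U, ∀ᵐ t ∂(volume.restrict (Icc 0 T)), H t (u t) ≤ H t c :=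
    fun c hc => ae_hamiltonian_le hT hadm hH
      (fun v hv => by rw [hHint u hadm, hHint v hv]; exact hmult v hv) (hU1 c hc)
  obtain ⟨S, hSfin, hS⟩ := exists_finite_slopes N U w
  have hlevel : ∀ s ∈ S, ∀ᵐ t ∂(volume.restrict (Icc 0 T)), q t ≠ -(p * s) :=
    fun s _ => ae_restrict_of_ae (ae_switching_ne hA hAB hφ _)
  filter_upwards [((supNormLE_iff zero_le_one).1 hadm).2,
    (ae_ball_iff (finite_alphabet N U).countable).2 hmin,
    (ae_ball_iff hSfin.countable).2 hlevel] with t hb hmt hlt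
  exact (mem_alphabet_or_slope h1 hneg1 hS hb hmt).resolve_right
    fun ⟨s, hs, hqs⟩ => hlt s hs hqs

end SOAV

theorem theorem3 (n : ℕ) (A : Matrix (Fin n) (Fin n) ℝ) (B : Fin n → ℝ)
    (T : ℝ) (hT : 0 < T)
    (N : ℕ) (hN : 1 ≤ N) (U w : ℕ → ℝ)
    (hU_nonneg : 0 ≤ U 1) (hU_mono : StrictMonoOn U (Set.Icc 1 N)) (hU_last : U N = 1)
    (hw_one : 0 < w 1) (hw_nonneg : ∀ i ∈ Finset.Icc 1 N, 0 ≤ w i)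
    (hw_sum : ∑ i ∈ Finset.Icc 1 N, w i = 1)
    (hA : A.det ≠ 0) (hAB : SOAV.Controllable A B) :
    -- `J_min` is the minimal cost over all controls with `‖u‖_∞ ≤ 1`
    IsLeast {J : ℝ | ∃ u : ℝ → ℝ, SOAV.SupNormLE T 1 u ∧ J = SOAV.cost N U w T u}
      (SOAV.Jmin N U w T) ∧
    -- the states whose optimal value is `J_min` are those reached with `‖u‖_∞ ≤ U_min`
    SOAV.Rmin A B N U w T = SOAV.reachSet A B T (U 1) ∧
    -- discreteness outside `R_min`
    (∀ ξ ∈ SOAV.reachSet A B T 1 \ SOAV.Rmin A B N U w T, ∀ u : ℝ → ℝ,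
      SOAV.IsOptimal A B N U w T ξ u →
        ∀ᵐ t ∂(MeasureTheory.volume.restrict (Set.Icc 0 T)), u t ∈ SOAV.alphabet N U) ∧
    -- the bound on `R_min`
    (∀ ξ ∈ SOAV.Rmin A B N U w T, ∀ u : ℝ → ℝ,
      SOAV.IsOptimal A B N U w T ξ u →
        ∀ᵐ t ∂(MeasureTheory.volume.restrict (Set.Icc 0 T)), |u t| ≤ U 1) := by
  open SOAV in
  have h1N : (1 : ℕ) ∈ Icc 1 N := ⟨le_rfl, hN⟩
  have hU1 : ∀ i ∈ Finset.Icc 1 N, U 1 ≤ U i := fun i hi => by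
    have hi' := Finset.mem_Icc.1 hi
    exact hU_mono.monotoneOn h1N hi' hi'.1
  have hUle : ∀ i ∈ Finset.Icc 1 N, U i ≤ 1 := fun i hi => by
    have hi' := Finset.mem_Icc.1 hi
    exact hU_last ▸ hU_mono.monotoneOn hi' ⟨hN, le_rfl⟩ hi'.2
  have hU1le : U 1 ≤ 1 := hUle 1 (Finset.mem_Icc.2 h1N)
  have hNmem : N ∈ Finset.Icc 1 N := Finset.mem_Icc.2 ⟨hN, le_rfl⟩
  have halph : ∀ c ∈ alphabet N U, |c| ≤ 1 := by
    rintro c ⟨i, hi, rfl | rfl⟩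
    · exact abs_le.2 ⟨by linarith [hU1 i hi], hUle i hi⟩
    · exact abs_le.2 ⟨by linarith [hUle i hi], by linarith [hU1 i hi]⟩
  have hiff := fun (u : ℝ → ℝ) (hu : SupNormLE T 1 u) =>
    cost_eq_Jmin_iff hN hT.le hU1 hw_one hw_nonneg hu
  have h0 : SupNormLE T 1 (fun _ => 0) :=
    (supNormLE_iff zero_le_one).2 ⟨aestronglyMeasurable_const, ae_of_all _ fun _ => by simp⟩
  have hcost0 : cost N U w T (fun _ => 0) = Jmin N U w T :=
    (hiff _ h0).2 (ae_of_all _ fun _ => by simpa using hU_nonneg)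
  refine ⟨⟨⟨fun _ => 0, h0, hcost0.symm⟩, ?_⟩, ?_, ?_, ?_⟩
  · rintro J ⟨u, hu, rfl⟩
    exact Jmin_le_cost hT.le hw_nonneg hu
  · ext ξ
    constructor
    · rintro ⟨u, hu, hcost⟩
      obtain ⟨hadm, hin⟩ := (mem_feasible_iff hT.le).1 hu.1
      refine ⟨fun t => -u t, SupNormLE.neg ((supNormLE_iff hU_nonneg).2
        ⟨hadm.1, (hiff u hadm).1 hcost⟩), ?_⟩
      exact ((inputMap_neg A B T u).trans (by rw [hin, neg_neg])).symm
    · rintro ⟨u, hu, hξ⟩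
      have hadm : SupNormLE T 1 (fun t => -u t) := hu.neg.mono hU1le
      have hcost : cost N U w T (fun t => -u t) = Jmin N U w T :=
        (hiff _ hadm).2 ((supNormLE_iff hU_nonneg).1 hu.neg).2
      refine ⟨fun t => -u t, ⟨(mem_feasible_iff hT.le).2 ⟨hadm, ?_⟩, fun v hv => ?_⟩, hcost⟩
      · rw [inputMap_neg, hξ, inputMap]
      · exact hcost.trans_le (Jmin_le_cost hT.le hw_nonneg hv.1)
  · rintro ξ ⟨-, hξ⟩ u hu
    refine hu.ae_mem_alphabet hA hAB halph ⟨N, hNmem, Or.inl hU_last.symm⟩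
      ⟨N, hNmem, Or.inr (by rw [hU_last])⟩ hT.le hw_nonneg h0 ?_
    rw [hcost0]
    exact lt_of_le_of_ne (Jmin_le_cost hT.le hw_nonneg hu.1.1) fun h => hξ ⟨u, hu, h.symm⟩
  · rintro ξ ⟨u₀, hu₀, hcost⟩ u hu
    refine (hiff u hu.1.1).1 (le_antisymm ?_ (Jmin_le_cost hT.le hw_nonneg hu.1.1))
    exact (hu.2 u₀ hu₀.1).trans_eq hcost
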